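/- Work over $\mathbb{C}$. Let $R=\mathbb{C}[x_0,\dots,x_3]$ and let $\mathbb{P}^3$ be the projective space of nonzero linear forms in $R$ up to scalars. A finite set $A=\{[L_1],\dots,[L_r]\}\subset\mathbb{P}^3$ of $r$ points is a decomposition of length $\ell(A)=r$ of a form $F\in R$ of degree $6$ if $F=\sum_{i=1}^r a_iL_i^6$ for some $a_i\in\mathbb{C}$. It is non-redundant if moreover $L_1^6,\dots,L_r^6$ are linearly independent and all $a_i$ are nonzero. For a finite set $A\subset\mathbb{P}^3$, let $I_A$ be its homogeneous ideal, generated by the forms that vanish at all points of $A$, and let $h_A(d)=\dim(R/I_A)_d$ be its Hilbert function. We say that $A$ is in general position if every subset $A'\subseteq A$ has maximal Hilbert function, i.e. $h_{A'}(d)=\min\{\ell(A'),\binom{d+3}{3}\}$ for all $d\ge 0$. Proposition. Let $A$ be a non-redundant decomposition of length $r\le 20$ of a form $F$ of degree $6$ in four variables, and suppose that $A$ is in general position. Let $B$ be any decomposition of $F$, of length $s$. Then $s\ge r$. Moreover, if $s\le r$ (so that $s=r$) and $Z=A\cup B$, then: (i) if $r=15$ and $B\ne A$, then $A\cap B=\emptyset$;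 (ii) the homogeneous ideals of $A$ and of $Z$ agree up to degree $3$, i.e. $(I_A)_d=(I_Z)_d$ for all $d\le 3$. -/

import Mathlib

/-- The projective space `ℙ³` of (nonzero) linear forms in four variables over `ℂ`, up to scalars:
the class of `v` is the class of the linear form `∑ i, v i * X i`. -/
abbrev PointP3 : Type := Projectivization ℂ (Fin 4 → ℂ)

/-- The linear form `∑ i, v i * X i`. -/
noncomputable def linearForm (v : Fin 4 → ℂ) : MvPolynomial (Fin 4) ℂ :=
  ∑ i : Fin 4, MvPolynomial.C (v i) * MvPolynomial.X i

/-- The sixth power `L ^ 6`, for a chosen representative `L` of the point `p`. Another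
representative changes it by a nonzero scalar, see `exists_linearForm_pow_six`. -/
noncomputable def sixthPower (p : PointP3) : MvPolynomial (Fin 4) ℂ :=
  linearForm p.rep ^ 6

theorem exists_linearForm_pow_six (v : Fin 4 → ℂ) (hv : v ≠ 0) :
    ∃ c : ℂ, c ≠ 0 ∧ linearForm v ^ 6 = c • sixthPower (Projectivization.mk ℂ v hv) := by
  obtain ⟨a, ha⟩ := Projectivization.exists_smul_eq_mk_rep ℂ v hv
  refine ⟨((a⁻¹ : ℂˣ) : ℂ) ^ 6, pow_ne_zero _ (Units.ne_zero _), ?_⟩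
  have h : v = ((a⁻¹ : ℂˣ) : ℂ) • (Projectivization.mk ℂ v hv).rep := by
    rw [← ha]
    change v = a⁻¹ • a • v
    rw [inv_smul_smul]
  have h2 : linearForm v =
      ((a⁻¹ : ℂˣ) : ℂ) • linearForm (Projectivization.mk ℂ v hv).rep := by
    conv_lhs => rw [h]
    simp only [linearForm, Pi.smul_apply, smul_eq_mul, map_mul, Finset.smul_sum,
      MvPolynomial.smul_eq_C_mul, mul_assoc]
  rw [h2, smul_pow, sixthPower]

/-- `A` is a (Waring) decomposition of `F`: `F` is a linear combination of the sixth powers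
of the linear forms in `A`, i.e. `F` lies in the span of `v₆(A)`. Its length is `A.card`. -/
def IsDecomposition (F : MvPolynomial (Fin 4) ℂ) (A : Finset PointP3) : Prop :=
  ∃ a : PointP3 → ℂ, F = ∑ p ∈ A, a p • sixthPower p

/-- `A` is a non-redundant decomposition of `F`: the powers are linearly independent and all the
coefficients are nonzero. -/
def IsNonredundantDecomposition (F : MvPolynomial (Fin 4) ℂ) (A : Finset PointP3) : Prop :=
  LinearIndependent ℂ (fun p : A => sixthPower (p : PointP3)) ∧
    ∃ a : PointP3 → ℂ, (∀ p ∈ A, a p ≠ 0) ∧ F = ∑ p ∈ A, a p • sixthPower p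

/-- The homogeneous ideal of a set `A ⊆ ℙ³`: the polynomials that vanish on the affine
cone over `A` (without its vertex). -/
noncomputable def homogeneousIdeal (A : Set PointP3) : Ideal (MvPolynomial (Fin 4) ℂ) :=
  MvPolynomial.vanishingIdeal ℂ
    {v : Fin 4 → ℂ | ∃ hv : v ≠ 0, Projectivization.mk ℂ v hv ∈ A}

/-- The Hilbert function `h_A(d) = dim (R / I_A)_d = dim R_d / (I_A)_d`. -/
noncomputable def hilbertFn (A : Set PointP3) (d : ℕ) : ℕ :=
  Module.finrank ℂ (MvPolynomial.homogeneousSubmodule (Fin 4) ℂ d ⧸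
    Submodule.comap (MvPolynomial.homogeneousSubmodule (Fin 4) ℂ d).subtype
      ((homogeneousIdeal A).restrictScalars ℂ))

/-- General position: every subset of `A` has maximal Hilbert function, i.e.
`h_{A'}(d) = min (ℓ(A')) (dim R_d)` for all `A' ⊆ A` and all `d`. -/
def InGeneralPosition (A : Finset PointP3) : Prop :=
  ∀ A' : Finset PointP3, A' ⊆ A → ∀ d : ℕ,
    hilbertFn (A' : Set PointP3) d = min A'.card (Nat.choose (d + 3) 3)

/-! Subtracting the decompositions gives a relation among sixth powers whose support `Z ⊆ A ∪ B`
contains `A \ B`. Dually, it is a relation with nonzero coefficients among the values of sextics at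
the points of `Z`. Dividing by a linear form that vanishes nowhere on `Z`, the values of forms of
degree `d` become the power `L ^ d` of a function space `L` containing `1`.

Since `L ^ 3 * L ^ 3 = L ^ 6`, the space `L ^ 3` is isotropic for the nondegenerate diagonal form
defined by the relation, so `2 dim L ^ 3 ≤ |Z|`, while general position gives `dim L ^ 3 ≥ |Z ∩ A|`.
Hence `|A \ B| ≤ |Z ∩ A| ≤ |Z \ A| ≤ |B \ A|`, so `r ≤ s`. If `s ≤ r`, all are equalities, `Z \ A =
B \ A`, and a cubic vanishing on `Z ∩ A` vanishes on `Z`: this is (ii).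

For (i), a common point leaves at most 14 points of `A` in `Z`. On the support of a minimal relation
there are `2k` points, `k ≤ 14`, and `h d = dim L ^ d` satisfies `h 3 = k`, `h 6 ≥ 2k - 1`, `h 2 ≥
min k 10`, `h 2 + h 4 ≤ 2k`. If `k ≤ 10`, growth stops in degree 2. Otherwise `h 4 - h 3 ≤ k - 10 ≤
4`, and a Macaulay-type bound (`exists_pow_succ_le_sup_map_mulLeft`, `finrank_pow_succ_succ_le`)
keeps later increments no larger, so `h 6 ≤ k + 3(k - 10) < 2k - 1`. -/

/-! ### Growth of the powers of a linear space -/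

open Module in
/-- If multiplication by no element of `L` maps `L ^ D` onto `L ^ (D + 1)` modulo `L ^ D`, there is
a triangular system of functionals on `L ^ (D + 1)` that vanish on `L ^ D`. -/
theorem exists_triangular_functionals {K R : Type*} [Field K] [Infinite K] [CommRing R]
    [Algebra K R] (L : Submodule K R) (D : ℕ)
    (h : ∀ l ∈ L, ∃ ψ : Dual K R, (∀ x ∈ L ^ D, ψ x = 0) ∧ (∀ x ∈ L ^ D, ψ (l * x) = 0) ∧
      ∃ y ∈ L ^ (D + 1), ψ y ≠ 0) (m : ℕ) (hm : m ≤ D + 1) :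
    ∃ (ψ : ℕ → Dual K R) (p : ℕ → R),
      (∀ i ≤ m, ∀ x ∈ L ^ D, ψ i x = 0) ∧
      (∀ i ≤ m, p i ∈ L ^ (m - i)) ∧
      (∀ i j, i < j → j ≤ m → ∀ y ∈ L ^ (D + 1 - (m - i)), ψ j (p i * y) = 0) ∧
      (∀ i ≤ m, ∃ x ∈ L ^ (D + 1 - (m - i)), ψ i (p i * x) ≠ 0) := by
  induction m with
  | zero =>
    obtain ⟨ψ, h1, -, h3⟩ := h 0 L.zero_mem
    refine ⟨fun _ => ψ, fun _ => 1, fun _ _ => h1, ?_, ?_, ?_⟩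
    · intro i hi
      rw [Nat.zero_sub, pow_zero]
      exact Submodule.one_le.mp le_rfl
    · intro i j hij hj
      omega
    · intro i hi
      simpa using h3
  | succ m ih =>
    obtain ⟨ψ, p, h1, h2, h3, h4⟩ := ih (by omega)
    have key : ∀ i : Fin (m + 1), ∃ x ∈ L ^ (D - (m - i)), ∃ l ∈ L, ψ i (p i * x * l) ≠ 0 := by
      intro i
      obtain ⟨w, hw, hne⟩ := h4 i (by omega)
      by_contra! hcon
      refine hne ?_
      rw [show D + 1 - (m - i) = D - (m - i) + 1 by omega, pow_succ] at hw
      induction hw using Submodule.mul_induction_on' with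
      | mem_mul_mem x hx l hl => rw [← mul_assoc]; exact hcon x hx l hl
      | add x _ y _ hx hy =>
        rw [mul_add, map_add]
        by_cases h0 : ψ i (p i * x) = 0
        · by_cases h0' : ψ i (p i * y) = 0
          · rw [h0, h0', add_zero]
          · exact absurd (hy h0') h0'
        · exact absurd (hx h0) h0
    choose x hx hxl using key
    -- Over an infinite field one `l` avoids finitely many proper kernels. The old `p i` absorb `l`;
    -- the functional supplied by `h` for this `l` joins with `p = 1`.
    obtain ⟨l, hl, hne⟩ := Module.Dual.exists_forall_mem_ne_zero_of_forall_exists L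
      (fun i : Fin (m + 1) => (ψ i).comp (LinearMap.mulLeft K (p i * x i))) hxl
    obtain ⟨φ, k1, k2, y, hy, k3⟩ := h l hl
    refine ⟨fun i => if i ≤ m then ψ i else φ, fun i => if i ≤ m then p i * l else 1,
      ?_, ?_, ?_, ?_⟩
    · intro i hi
      by_cases him : i ≤ m
      · simpa [him] using h1 i him
      · simpa [him] using k1
    · intro i hi
      by_cases him : i ≤ m
      · simp only [him, if_true]
        rw [show m + 1 - i = m - i + 1 by omega, pow_succ]
        exact Submodule.mul_mem_mul (h2 i him) hl
      · simp only [him, if_false]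
        rw [show m + 1 - i = 0 by omega, pow_zero]
        exact Submodule.one_le.mp le_rfl
    · intro i j hij hj z hz
      have him : i ≤ m := by omega
      simp only [him, if_true]
      by_cases hjm : j ≤ m
      · simp only [hjm, if_true]
        rw [mul_assoc]
        refine h3 i j hij hjm _ ?_
        rw [show D + 1 - (m - i) = D + 1 - (m + 1 - i) + 1 by omega, pow_succ']
        exact Submodule.mul_mem_mul hl hz
      · simp only [hjm, if_false]
        rw [mul_comm (p i), mul_assoc]
        refine k2 _ ?_
        have hmem := Submodule.mul_mem_mul (h2 i him) hz
        rwa [← pow_add, show (m - i) + (D + 1 - (m + 1 - i)) = D by omega] at hmem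
    · intro i hi
      by_cases him : i ≤ m
      · simp only [him, if_true]
        refine ⟨x ⟨i, by omega⟩, ?_, ?_⟩
        · rw [show D + 1 - (m + 1 - i) = D - (m - i) by omega]
          exact hx ⟨i, by omega⟩
        · have := hne ⟨i, by omega⟩
          simp only [LinearMap.comp_apply, LinearMap.mulLeft_apply] at this
          rwa [mul_right_comm]
      · simp only [him, if_false]
        refine ⟨y, ?_, by simpa using k3⟩
        rwa [show D + 1 - (m + 1 - i) = D + 1 by omega]

open Module in
/-- A standard graded algebra whose dimension in degree `D + 1` is at most `D + 1` is generated in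
this degree by a single linear form over the preceding degree. -/
theorem exists_pow_succ_le_sup_map_mulLeft {K R : Type*} [Field K] [Infinite K] [CommRing R]
    [Algebra K R] [FiniteDimensional K R] (L : Submodule K R) (h1 : 1 ∈ L) (D : ℕ)
    (h : finrank K ↥(L ^ (D + 1)) ≤ finrank K ↥(L ^ D) + (D + 1)) :
    ∃ l ∈ L, L ^ (D + 1) ≤ L ^ D ⊔ (L ^ D).map (LinearMap.mulLeft K l) := by
  by_contra! hcon
  have hle : L ^ D ≤ L ^ (D + 1) := by
    intro x hx
    rw [pow_succ, ← mul_one x]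
    exact Submodule.mul_mem_mul hx h1
  obtain ⟨ψ, p, k1, k2, k3, k4⟩ := exists_triangular_functionals L D (by
    intro l hl
    obtain ⟨y, hy, hny⟩ := SetLike.not_le_iff_exists.mp (hcon l hl)
    obtain ⟨ψ, hψ, hker⟩ := Submodule.exists_le_ker_of_notMem hny
    exact ⟨ψ, fun x hx => hker (Submodule.mem_sup_left hx),
      fun x hx => hker (Submodule.mem_sup_right ⟨x, hx, rfl⟩), y, hy, hψ⟩) (D + 1) le_rfl
  set W := L ^ (D + 1) with hW
  have hli : LinearIndependent K (fun i : Fin (D + 2) => (ψ i).domRestrict W) := by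
    rw [Fintype.linearIndependent_iff]
    intro g hg
    by_contra! hne
    -- At `p i * x`, later functionals vanish by triangularity and earlier ones have coefficient
    -- zero by minimality.
    obtain ⟨i, hi, hmin⟩ := WellFounded.has_min (wellFounded_lt (α := Fin (D + 2))) {i | g i ≠ 0} hne
    obtain ⟨x, hx, hxne⟩ := k4 i (by omega)
    have hpx : p i * x ∈ W := by
      have hmem := Submodule.mul_mem_mul (k2 i (by omega)) hx
      rwa [← pow_add, show (D + 1 - i : ℕ) + (D + 1 - (D + 1 - i)) = D + 1 by omega] at hmem
    have hev := congr($hg ⟨p i * x, hpx⟩)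
    rw [LinearMap.sum_apply, Finset.sum_eq_single i] at hev
    · simp only [LinearMap.smul_apply, LinearMap.domRestrict_apply, smul_eq_mul,
        LinearMap.zero_apply] at hev
      exact (mul_ne_zero hi hxne) hev
    · intro j _ hji
      rcases lt_or_gt_of_ne hji with hlt | hgt
      · have : g j = 0 := by
          by_contra h0
          exact hmin j h0 hlt
        simp [this]
      · simp [k3 i j hgt (by omega) x hx]
    · simp
  -- The `D + 2` independent functionals live in the dual of `L ^ (D + 1) / L ^ D`, of dimension at
  -- most `D + 1`.
  set N : Submodule K W := (L ^ D).comap W.subtype with hN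
  have hNrank : finrank K N = finrank K ↥(L ^ D) :=
    (Submodule.comapSubtypeEquivOfLe hle).finrank_eq
  have hmem : ∀ i : Fin (D + 2), (ψ i).domRestrict W ∈ N.dualAnnihilator := by
    intro i
    rw [Submodule.mem_dualAnnihilator]
    intro w hw
    exact k1 i (by omega) _ hw
  have hli' : LinearIndependent K
      (fun i : Fin (D + 2) => (⟨(ψ i).domRestrict W, hmem i⟩ : N.dualAnnihilator)) :=
    LinearIndependent.of_comp N.dualAnnihilator.subtype hli
  have hcard := hli'.fintype_card_le_finrank
  have hsum := Subspace.finrank_add_finrank_dualAnnihilator_eq N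
  rw [Fintype.card_fin] at hcard
  omega

-- Since `l * L ^ D` already lies in `L ^ (D + 1)`, only `l` times a complement of `L ^ D` in `L ^
-- (D + 1)` can be new in the next degree: increments do not grow.
open Module in
theorem finrank_pow_succ_succ_le {K R : Type*} [Field K] [CommRing R] [Algebra K R]
    [FiniteDimensional K R] (L : Submodule K R) (h1 : 1 ∈ L) (D : ℕ) (l : R) (hl : l ∈ L)
    (h : L ^ (D + 1) ≤ L ^ D ⊔ (L ^ D).map (LinearMap.mulLeft K l)) :
    L ^ (D + 2) ≤ L ^ (D + 1) ⊔ (L ^ (D + 1)).map (LinearMap.mulLeft K l) ∧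
      finrank K ↥(L ^ (D + 2)) + finrank K ↥(L ^ D) ≤ 2 * finrank K ↥(L ^ (D + 1)) := by
  have hle : L ^ D ≤ L ^ (D + 1) := by
    intro x hx
    rw [pow_succ, ← mul_one x]
    exact Submodule.mul_mem_mul hx h1
  have hsup : L ^ (D + 2) ≤ L ^ (D + 1) ⊔ (L ^ (D + 1)).map (LinearMap.mulLeft K l) := by
    rw [pow_succ, Submodule.mul_le]
    intro x hx y hy
    obtain ⟨u, hu, _, ⟨v, hv, rfl⟩, rfl⟩ := Submodule.mem_sup.mp (h hx)
    rw [add_mul]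
    refine Submodule.add_mem_sup ?_ ⟨v * y, ?_, by simp [mul_assoc]⟩
    · rw [pow_succ]; exact Submodule.mul_mem_mul hu hy
    · rw [pow_succ]; exact Submodule.mul_mem_mul hv hy
  refine ⟨hsup, ?_⟩
  have hlD : (L ^ D).map (LinearMap.mulLeft K l) ≤ L ^ (D + 1) := by
    rintro _ ⟨x, hx, rfl⟩
    rw [pow_succ']
    exact Submodule.mul_mem_mul hl hx
  obtain ⟨C, hC⟩ := ((L ^ D).comap (L ^ (D + 1)).subtype).exists_isCompl
  set C' := C.map (L ^ (D + 1)).subtype with hC'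
  have hdim : finrank K ↥(L ^ D) + finrank K C' = finrank K ↥(L ^ (D + 1)) := by
    rw [← Submodule.finrank_add_eq_of_isCompl hC, hC',
      (Submodule.comapSubtypeEquivOfLe hle).finrank_eq, Submodule.finrank_map_subtype_eq]
  have hle2 : L ^ (D + 2) ≤ L ^ (D + 1) ⊔ C'.map (LinearMap.mulLeft K l) := by
    refine hsup.trans (sup_le le_sup_left ?_)
    rintro _ ⟨x, hx, rfl⟩
    have hx' : (⟨x, hx⟩ : ↥(L ^ (D + 1))) ∈ (L ^ D).comap (L ^ (D + 1)).subtype ⊔ C := by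
      rw [hC.sup_eq_top]; trivial
    obtain ⟨u, hu, v, hv, huv⟩ := Submodule.mem_sup.mp hx'
    have hxe : x = u + v := by rw [← Submodule.coe_add, huv]
    rw [hxe, map_add]
    exact Submodule.add_mem_sup (hlD ⟨u, hu, rfl⟩) ⟨v, ⟨v, hv, rfl⟩, rfl⟩
  have e1 := Submodule.finrank_mono hle2
  have e2 := Submodule.finrank_add_le_finrank_add_finrank (L ^ (D + 1)) (C'.map (LinearMap.mulLeft K l))
  have e3 := Submodule.finrank_map_le (LinearMap.mulLeft K l) C'
  omega

/-! ### Orthogonality and interpolation from a relation -/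

open Module in
/-- Two subspaces that are orthogonal for a nondegenerate diagonal form. -/
theorem finrank_add_finrank_le_card_of_orthogonal {K ι : Type*} [Field K] [Fintype ι]
    (c : ι → K) (hc : ∀ i, c i ≠ 0) (U W : Submodule K (ι → K))
    (h : ∀ f ∈ U, ∀ g ∈ W, ∑ i, c i * (f i * g i) = 0) :
    finrank K U + finrank K W ≤ Fintype.card ι := by
  classical
  let B : (ι → K) →ₗ[K] Dual K (ι → K) := LinearMap.mk₂ K (fun f g => ∑ i, c i * (f i * g i))
    (fun f f' g => by simp [add_mul, mul_add, Finset.sum_add_distrib])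
    (fun a f g => by
      rw [smul_eq_mul, Finset.mul_sum]
      exact Finset.sum_congr rfl fun i _ => by simp only [Pi.smul_apply, smul_eq_mul]; ring)
    (fun f g g' => by simp [mul_add, Finset.sum_add_distrib])
    (fun a f g => by
      rw [smul_eq_mul, Finset.mul_sum]
      exact Finset.sum_congr rfl fun i _ => by simp only [Pi.smul_apply, smul_eq_mul]; ring)
  have hB : Function.Injective B := by
    rw [injective_iff_map_eq_zero]
    intro f hf
    ext i
    have h1 := congr($hf (Pi.single i 1))
    have h2 : B f (Pi.single i 1) = c i * f i := by
      change ∑ j, c j * (f j * (Pi.single i 1 : ι → K) j) = _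
      rw [Finset.sum_eq_single i] <;> simp +contextual
    rw [h2] at h1
    exact (mul_eq_zero.mp h1).resolve_left (hc i)
  have hmap : U.map B ≤ W.dualAnnihilator := by
    rintro _ ⟨f, hf, rfl⟩
    rw [Submodule.mem_dualAnnihilator]
    exact fun g hg => h f hf g hg
  have h1 := Submodule.finrank_mono hmap
  rw [← (Submodule.equivMapOfInjective B hB U).finrank_eq] at h1
  have h2 := Subspace.finrank_add_finrank_dualAnnihilator_eq W
  rw [Module.finrank_fintype_fun_eq_card] at h2
  omega

/-- `V` interpolates arbitrary values at the points of `S`. -/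
def Interpolates {K ι : Type*} [Field K] (V : Submodule K (ι → K)) (S : Finset ι) : Prop :=
  ∀ g : ι → K, ∃ f ∈ V, ∀ i ∈ S, f i = g i

open Module in
theorem Interpolates.card_le_finrank {K ι : Type*} [Field K] [Finite ι]
    {V : Submodule K (ι → K)} {S : Finset ι} (h : Interpolates V S) :
    S.card ≤ finrank K V ∧ (finrank K V ≤ S.card → ∀ f ∈ V, (∀ i ∈ S, f i = 0) → f = 0) := by
  classical
  let ρ : V →ₗ[K] (S → K) := (LinearMap.funLeft K K (Subtype.val : S → ι)).comp V.subtype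
  have hρ : Function.Surjective ρ := by
    intro g
    obtain ⟨f, hf, hfg⟩ := h (fun i => if hi : i ∈ S then g ⟨i, hi⟩ else 0)
    refine ⟨⟨f, hf⟩, ?_⟩
    ext i
    change f i = g i
    rw [hfg i i.2, dif_pos i.2]
  have hle := LinearMap.finrank_le_finrank_of_surjective hρ
  rw [Module.finrank_fintype_fun_eq_card, Fintype.card_coe] at hle
  refine ⟨hle, fun hge f hf hS => ?_⟩
  have hinj : Function.Injective ρ :=
    (LinearMap.injective_iff_surjective_of_finrank_eq_finrank (by
      rw [Module.finrank_fintype_fun_eq_card, Fintype.card_coe]; omega)).mpr hρ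
  have h0 : (⟨f, hf⟩ : V) = 0 := hinj (by
    rw [map_zero]
    ext i
    exact hS i i.2)
  exact congrArg Subtype.val h0

open Module in
theorem interpolates_of_finrank {K ι : Type*} [Field K] [Finite ι]
    {V : Submodule K (ι → K)} {S : Finset ι} (h : finrank K V = S.card)
    (h0 : ∀ f ∈ V, (∀ i ∈ S, f i = 0) → f = 0) : Interpolates V S := by
  let ρ : V →ₗ[K] (S → K) := (LinearMap.funLeft K K (Subtype.val : S → ι)).comp V.subtype
  have hinj : Function.Injective ρ := by
    rw [injective_iff_map_eq_zero]
    intro f hf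
    exact Subtype.ext (h0 f f.2 fun i hi => congr($hf ⟨i, hi⟩))
  have hsurj := (LinearMap.injective_iff_surjective_of_finrank_eq_finrank (by
      rw [Module.finrank_fintype_fun_eq_card, Fintype.card_coe]; omega)).mp hinj
  intro g
  obtain ⟨f, hf⟩ := hsurj (fun i => g i)
  exact ⟨f, f.2, fun i hi => congr($hf ⟨i, hi⟩)⟩

/-- `c` is a linear relation among the evaluations of `V`. -/
def IsRelation {K ι : Type*} [Field K] [Fintype ι] (V : Submodule K (ι → K)) (c : ι → K) : Prop :=
  ∀ f ∈ V, ∑ i, c i * f i = 0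

open Module in
theorem IsRelation.finrank_pow_add_le {K ι : Type*} [Field K] [Fintype ι]
    {L : Submodule K (ι → K)} {d e : ℕ} {c : ι → K} (h : IsRelation (L ^ (d + e)) c)
    (hc : ∀ i, c i ≠ 0) : finrank K ↥(L ^ d) + finrank K ↥(L ^ e) ≤ Fintype.card ι := by
  refine finrank_add_finrank_le_card_of_orthogonal c hc _ _ fun f hf g hg => ?_
  refine h (f * g) ?_
  rw [pow_add]
  exact Submodule.mul_mem_mul hf hg

/-- A relation of degree `2 * d` with full support: a set that is independent in degree `d`
contains at most half of the points. -/
theorem IsRelation.two_mul_card_le {K ι : Type*} [Field K] [Fintype ι]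
    {L : Submodule K (ι → K)} {d : ℕ} {c : ι → K} (h : IsRelation (L ^ (d + d)) c)
    (hc : ∀ i, c i ≠ 0) {S : Finset ι} (hS : Interpolates (L ^ d) S) :
    2 * S.card ≤ Fintype.card ι := by
  have h1 := h.finrank_pow_add_le hc
  have h2 := hS.card_le_finrank.1
  omega

open Module in
theorem IsRelation.finrank_eq {K ι : Type*} [Field K] [Fintype ι]
    {L : Submodule K (ι → K)} {d : ℕ} {c : ι → K} (h : IsRelation (L ^ (d + d)) c)
    (hc : ∀ i, c i ≠ 0) {S : Finset ι} (hS : Interpolates (L ^ d) S)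
    (hcard : Fintype.card ι ≤ 2 * S.card) : finrank K ↥(L ^ d) = S.card := by
  have h1 := h.finrank_pow_add_le hc
  have h2 := hS.card_le_finrank.1
  omega

/-- A Cayley–Bacharach argument: if `f` vanishes off `S`, pairing it with a `g` that is the
indicator of `j` on `S` leaves only `c j * f j = 0`. So restriction to the complement is injective,
and the dimensions agree. -/
theorem IsRelation.interpolates_compl {K ι : Type*} [Field K] [Fintype ι] [DecidableEq ι]
    {L : Submodule K (ι → K)} {d : ℕ} {c : ι → K} (h : IsRelation (L ^ (d + d)) c)
    (hc : ∀ i, c i ≠ 0) {S : Finset ι} (hS : Interpolates (L ^ d) S)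
    (hcard : Fintype.card ι ≤ 2 * S.card) : Interpolates (L ^ d) Sᶜ := by
  have hrank := h.finrank_eq hc hS hcard
  have hle := h.two_mul_card_le hc hS
  have hS0 := hS.card_le_finrank.2 hrank.le
  refine interpolates_of_finrank (by rw [hrank, Finset.card_compl]; omega) fun f hf hf0 => ?_
  refine hS0 f hf fun j hj => ?_
  obtain ⟨g, hg, hgj⟩ := hS (Pi.single j 1)
  have hsum := h (f * g) (by rw [pow_add]; exact Submodule.mul_mem_mul hf hg)
  rw [Finset.sum_eq_single j] at hsum
  · rw [Pi.mul_apply, hgj j hj, Pi.single_eq_same, mul_one] at hsum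
    exact (mul_eq_zero.mp hsum).resolve_left (hc j)
  · intro i _ hij
    by_cases hi : i ∈ S
    · simp [hgj i hi, hij]
    · simp [hf0 i (Finset.mem_compl.mpr hi)]
  · simp

/-! ### Excluding small relations in degree six -/

theorem pow_le_pow_of_one_mem {K R : Type*} [Field K] [CommRing R] [Algebra K R]
    {L : Submodule K R} (h1 : 1 ∈ L) {m n : ℕ} (hmn : m ≤ n) : L ^ m ≤ L ^ n :=
  pow_le_pow_right' (Submodule.one_le.mpr h1) hmn

open Module in
/-- The numerical contradiction behind the disjointness statement: the dimensions of the powers of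
`L` cannot be those of a set of `2 * k` points with a unique relation in degree six. -/
theorem false_of_finrank_pow_six {K ι : Type*} [Field K] [Infinite K] [Fintype ι]
    {L : Submodule K (ι → K)} (h1 : 1 ∈ L) (hsep : ∀ i j, i ≠ j → ∃ f ∈ L, f i ≠ f j)
    {c : ι → K} (h : IsRelation (L ^ 6) c) (hc : ∀ i, c i ≠ 0) {k : ℕ} (hk0 : 0 < k) (hk : k ≤ 14)
    (hcard : Fintype.card ι = 2 * k) (h3 : finrank K ↥(L ^ 3) = k)
    (h2 : min k 10 ≤ finrank K ↥(L ^ 2)) (h6 : 2 * k ≤ finrank K ↥(L ^ 6) + 1) : False := by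
  have h24 : finrank K ↥(L ^ 2) + finrank K ↥(L ^ 4) ≤ _ :=
    IsRelation.finrank_pow_add_le (d := 2) (e := 4) h hc
  rcases le_or_gt k 10 with hk10 | hk10
  · rw [min_eq_left hk10] at h2
    have h23 : L ^ 2 = L ^ 3 :=
      Submodule.eq_of_le_of_finrank_le (pow_le_pow_of_one_mem h1 (by norm_num)) (by omega)
    have h36 : L ^ 6 = L ^ 3 := by
      calc L ^ 6 = L ^ 3 * L ^ 3 := by rw [← pow_add]
        _ = L ^ 2 * L ^ 2 := by rw [h23]
        _ = L ^ 3 * L := by rw [← pow_add, ← pow_succ]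
        _ = L ^ 3 := by rw [← h23, ← pow_succ, ← h23]
    rw [h36, h3] at h6
    -- Stabilisation gives `2k ≤ k + 1`; then `L ^ 3` contains only constants and cannot separate
    -- the two points.
    obtain rfl : k = 1 := by omega
    obtain ⟨i, j, hij⟩ := Fintype.exists_pair_of_one_lt_card (α := ι) (by omega)
    obtain ⟨f, hf, hfij⟩ := hsep i j hij
    have hL3 : L ≤ L ^ 3 := by
      conv_lhs => rw [← pow_one L]
      exact pow_le_pow_of_one_mem h1 (by norm_num)
    obtain ⟨v, hv⟩ := finrank_eq_one_iff'.mp h3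
    obtain ⟨a, ha⟩ := hv.2 ⟨1, hL3 h1⟩
    obtain ⟨b, hb⟩ := hv.2 ⟨f, hL3 hf⟩
    have ha' : ∀ t, a * (v : ι → K) t = 1 := fun t => congr(($ha : ι → K) t)
    have hb' : ∀ t, b * (v : ι → K) t = f t := fun t => congr(($hb : ι → K) t)
    apply hfij
    have ha0 : a ≠ 0 := by
      rintro rfl
      simpa using ha' i
    have hvij : (v : ι → K) i = (v : ι → K) j :=
      mul_left_cancel₀ ha0 ((ha' i).trans (ha' j).symm)
    rw [← hb', ← hb', hvij]
  · rw [min_eq_right hk10.le] at h2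
    -- `dim L ^ 4 ≤ 2k - 10 ≤ k + 4`, by `k ≤ 14`.
    obtain ⟨l, hl, hl4⟩ := exists_pow_succ_le_sup_map_mulLeft L h1 3 (by simp only [Nat.reduceAdd]; omega)
    obtain ⟨hl5, h5⟩ := finrank_pow_succ_succ_le L h1 3 l hl hl4
    obtain ⟨-, h6'⟩ := finrank_pow_succ_succ_le L h1 4 l hl hl5
    simp only [Nat.reduceAdd] at h5 h6'
    omega

/-- Restriction of functions along a map, as an algebra homomorphism. -/
def pullbackAlgHom (K : Type*) {ι κ : Type*} [Field K] (e : κ → ι) : (ι → K) →ₐ[K] (κ → K) :=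
  AlgHom.pi fun j => Pi.evalAlgHom K (fun _ => K) (e j)

@[simp]
theorem pullbackAlgHom_apply {K ι κ : Type*} [Field K] (e : κ → ι) (f : ι → K) (j : κ) :
    pullbackAlgHom K e f j = f (e j) := rfl

theorem Interpolates.pullback {K ι κ : Type*} [Field K] {V : Submodule K (ι → K)} {S : Finset ι}
    (h : Interpolates V S) {e : κ → ι} (he : Function.Injective e) {S' : Finset κ}
    (hS' : ∀ j ∈ S', e j ∈ S) : Interpolates (V.map (pullbackAlgHom K e).toLinearMap) S' := by
  intro g
  obtain ⟨f, hf, hfg⟩ := h (Function.extend e g 0)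
  refine ⟨_, ⟨f, hf, rfl⟩, fun j hj => ?_⟩
  rw [AlgHom.toLinearMap_apply, pullbackAlgHom_apply, hfg _ (hS' j hj), he.extend_apply]

theorem sum_subtype_of_ne_zero {K ι : Type*} [Field K] [Fintype ι] (p : ι → Prop) [DecidablePred p]
    (c f : ι → K) (hc : ∀ i, ¬ p i → c i = 0) : ∑ i : {i // p i}, c i * f i = ∑ i, c i * f i := by
  rw [← Finset.sum_subtype (Finset.univ.filter p) (by simp) fun i => c i * f i]
  refine Finset.sum_subset (Finset.subset_univ _) fun i _ hi => ?_
  rw [hc i (by simpa using hi), zero_mul]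

-- Passing to a relation of minimal support makes it unique up to scalars there, which supplies the
-- lower bound on `L ^ 6` needed in `false_of_finrank_pow_six`.
open Module in
theorem false_of_isRelation_pow_six {K ι : Type*} [Field K] [Infinite K] [Fintype ι]
    {L : Submodule K (ι → K)} (h1 : 1 ∈ L) (hsep : ∀ i j, i ≠ j → ∃ f ∈ L, f i ≠ f j)
    {c : ι → K} (h : IsRelation (L ^ 6) c) (hc : ∀ i, c i ≠ 0) {S : Finset ι}
    (hS : Interpolates (L ^ 3) S) (hcard : Fintype.card ι = 2 * S.card) (hS0 : 0 < S.card)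
    (hS14 : S.card ≤ 14)
    (h2 : ∀ T ⊆ S, min T.card 10 ≤
      finrank K ↥((L ^ 2).map (pullbackAlgHom K (Subtype.val : T → ι)).toLinearMap)) : False := by
  classical
  obtain ⟨s, hs⟩ := Finset.card_pos.mp hS0
  obtain ⟨b, ⟨hb0, hb⟩, hmin⟩ := (measure fun b : ι → K =>
      (Finset.univ.filter fun i => b i ≠ 0).card).wf.has_min {b | b ≠ 0 ∧ IsRelation (L ^ 6) b}
    ⟨c, fun h0 => hc s (congrFun h0 s), h⟩
  let φ := pullbackAlgHom K (Subtype.val : {i // b i ≠ 0} → ι)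
  let M := L.map φ.toLinearMap
  have hM : ∀ d, M ^ d = (L ^ d).map φ.toLinearMap := fun d => (Submodule.map_pow L φ d).symm
  have hbM : IsRelation (M ^ 6) (fun i : {i // b i ≠ 0} => b i) := by
    rw [hM]
    rintro _ ⟨f, hf, rfl⟩
    exact (sum_subtype_of_ne_zero _ b f (by simp)).trans (hb f hf)
  have hbκ : ∀ i : {i // b i ≠ 0}, b i ≠ 0 := fun i => i.2
  let T : Finset {i // b i ≠ 0} := Finset.univ.filter fun i => (i : ι) ∈ S
  have hT : Interpolates (M ^ 3) T := by
    rw [hM]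
    exact hS.pullback Subtype.val_injective fun j hj => (Finset.mem_filter.mp hj).2
  have hTc : Interpolates (M ^ 3) Tᶜ := by
    rw [hM]
    refine (IsRelation.interpolates_compl (d := 3) h hc hS hcard.le).pullback
      Subtype.val_injective fun j hj => ?_
    simpa [T] using hj
  -- Both `T` and its complement interpolate cubics, so each is exactly half of the support.
  have hT1 := IsRelation.two_mul_card_le (d := 3) hbM hbκ hT
  have hT2 := IsRelation.two_mul_card_le (d := 3) hbM hbκ hTc
  have hTcard := Finset.card_add_card_compl T
  have hTS : T.card ≤ S.card := by
    refine Finset.card_le_card_of_injOn Subtype.val (fun j hj => (Finset.mem_filter.mp hj).2)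
      Subtype.val_injective.injOn
  obtain ⟨t, ht⟩ : ∃ t, b t ≠ 0 := Function.ne_iff.mp hb0
  have hκ : 0 < Fintype.card {i // b i ≠ 0} := Fintype.card_pos_iff.mpr ⟨⟨t, ht⟩⟩
  refine false_of_finrank_pow_six (L := M) (k := T.card) ⟨1, h1, map_one φ⟩ ?_ hbM hbκ (by omega)
    (by omega) (by omega) (IsRelation.finrank_eq (d := 3) hbM hbκ hT (by omega)) ?_ ?_
  · intro i j hij
    obtain ⟨f, hf, hne⟩ := hsep i j (fun h => hij (Subtype.ext h))
    exact ⟨_, ⟨f, hf, rfl⟩, hne⟩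
  · have hsub : T.map (Function.Embedding.subtype _) ⊆ S := by
      intro i hi
      obtain ⟨j, hj, rfl⟩ := Finset.mem_map.mp hi
      exact (Finset.mem_filter.mp hj).2
    have hT' := h2 _ hsub
    rw [Finset.card_map] at hT'
    refine hT'.trans ?_
    let e : ↥(T.map (Function.Embedding.subtype _)) → {i // b i ≠ 0} := fun i =>
      ⟨i, by
        obtain ⟨j, -, hj⟩ := Finset.mem_map.mp i.2
        rw [← hj]
        exact j.2⟩
    have hcomp : (L ^ 2).map (pullbackAlgHom K
        (Subtype.val : ↥(T.map (Function.Embedding.subtype _)) → ι)).toLinearMap =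
        (M ^ 2).map (pullbackAlgHom K e).toLinearMap := by
      rw [hM, ← Submodule.map_comp]
      rfl
    rw [hcomp]
    exact Submodule.finrank_map_le _ _
  · have hann : ∀ ψ ∈ (M ^ 6).dualAnnihilator, ∃ a : K,
        a • (∑ i : {i // b i ≠ 0}, b i • LinearMap.proj i : Dual K ({i // b i ≠ 0} → K)) = ψ := by
      intro ψ hψ
      rw [Submodule.mem_dualAnnihilator] at hψ
      let w : ι → K := fun i => if hi : b i ≠ 0 then ψ (Pi.single ⟨i, hi⟩ 1) else 0
      have hw : ∀ i : {i // b i ≠ 0}, w i = ψ (Pi.single i 1) := fun i => dif_pos i.2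
      have hψw : ∀ g : {i // b i ≠ 0} → K, ψ g = ∑ i : {i // b i ≠ 0}, w i * g i := by
        intro g
        conv_lhs => rw [pi_eq_sum_univ' g]
        rw [map_sum]
        refine Finset.sum_congr rfl fun i _ => ?_
        rw [map_smul, smul_eq_mul, mul_comm, hw]
      have hwrel : IsRelation (L ^ 6) w := by
        intro f hf
        rw [← sum_subtype_of_ne_zero (fun i => b i ≠ 0) w f (fun i hi => dif_neg hi)]
        refine (hψw (φ f)).symm.trans (hψ _ ?_)
        rw [hM]
        exact ⟨f, hf, rfl⟩
      refine ⟨w t / b t, ?_⟩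
      -- The difference is a relation supported inside the support of `b` and zero at `t`;
      -- minimality kills it.
      have hzero : w - (w t / b t) • b = 0 := by
        by_contra hne
        refine hmin (w - (w t / b t) • b) ⟨hne, fun f hf => ?_⟩ ?_
        · have e1 := hwrel f hf
          have e2 := hb f hf
          simp only [Pi.sub_apply, Pi.smul_apply, smul_eq_mul, sub_mul, Finset.sum_sub_distrib,
            mul_assoc, ← Finset.mul_sum, e1, e2]
          simp
        · refine Finset.card_lt_card ((Finset.ssubset_iff_of_subset ?_).mpr ⟨t, by simpa using ht, ?_⟩)
          · intro i hi
            simp only [Finset.mem_filter, Finset.mem_univ, true_and] at hi ⊢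
            intro hbi
            apply hi
            simp [w, hbi]
          · simp [div_mul_cancel₀ _ ht]
      ext i
      have hi := congrFun hzero i
      simp only [Pi.sub_apply, Pi.smul_apply, smul_eq_mul, Pi.zero_apply, sub_eq_zero] at hi
      have e1 : ψ (Pi.single i 1) = w i := (hw i).symm
      simp only [LinearMap.comp_apply, LinearMap.single_apply, e1, hi, LinearMap.smul_apply,
        LinearMap.sum_apply, LinearMap.proj_apply, smul_eq_mul]
      rw [Finset.sum_eq_single i] <;> simp +contextual
    have hle : finrank K (M ^ 6).dualAnnihilator ≤ 1 := by
      have : (M ^ 6).dualAnnihilator ≤ K ∙ (∑ i : {i // b i ≠ 0}, b i • LinearMap.proj i : Dual K ({i // b i ≠ 0} → K)) :=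
        fun ψ hψ => Submodule.mem_span_singleton.mpr (hann ψ hψ)
      exact (Submodule.finrank_mono this).trans ((finrank_span_le_card _).trans (by simp))
    have hsum := Subspace.finrank_add_finrank_dualAnnihilator_eq (M ^ 6)
    rw [Module.finrank_fintype_fun_eq_card] at hsum
    omega

/-! ### From sixth powers to values of forms -/

open MvPolynomial in
theorem eval_smul_of_isHomogeneous {σ K : Type*} [Fintype σ] [Field K] {f : MvPolynomial σ K}
    {d : ℕ} (hf : f.IsHomogeneous d) (t : K) (v : σ → K) : eval (t • v) f = t ^ d * eval v f := by
  rw [eval_eq', eval_eq', Finset.mul_sum]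
  refine Finset.sum_congr rfl fun m hm => ?_
  have hdeg : ∑ i, m i = d := by
    rw [← Finsupp.degree_eq_sum, Finsupp.degree_eq_weight_one]
    exact hf (mem_support_iff.mp hm)
  simp only [Pi.smul_apply, smul_eq_mul, mul_pow, Finset.prod_mul_distrib,
    Finset.prod_pow_eq_pow_sum, hdeg]
  ring

theorem eval_linearForm (v w : Fin 4 → ℂ) :
    MvPolynomial.eval w (linearForm v) = ∑ i, v i * w i := by
  simp [linearForm]

theorem isHomogeneous_linearForm (v : Fin 4 → ℂ) : (linearForm v).IsHomogeneous 1 := by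
  refine MvPolynomial.IsHomogeneous.sum _ _ _ fun i _ => ?_
  exact MvPolynomial.IsHomogeneous.C_mul (MvPolynomial.isHomogeneous_X _ _) _

theorem mem_homogeneousIdeal_iff {A : Set PointP3} {f : MvPolynomial (Fin 4) ℂ} {d : ℕ}
    (hf : f.IsHomogeneous d) :
    f ∈ homogeneousIdeal A ↔ ∀ p ∈ A, MvPolynomial.eval p.rep f = 0 := by
  rw [homogeneousIdeal, MvPolynomial.mem_vanishingIdeal_iff]
  constructor
  · intro h p hp
    exact h p.rep ⟨p.rep_nonzero, by rwa [Projectivization.mk_rep]⟩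
  · rintro h v ⟨hv, hvA⟩
    obtain ⟨a, ha⟩ := Projectivization.exists_smul_eq_mk_rep ℂ v hv
    have h0 := h _ hvA
    rw [← ha, Units.smul_def, eval_smul_of_isHomogeneous hf] at h0
    exact (mul_eq_zero.mp h0).resolve_left (pow_ne_zero _ a.ne_zero)

open MvPolynomial in
/-- A relation among the powers `L ^ n` of linear forms is a relation among the evaluations of
forms of degree `n`. -/
theorem sum_mul_eval_eq_zero (Z : Finset PointP3) (c : PointP3 → ℂ)
    (h : ∑ p ∈ Z, c p • sixthPower p = 0) {f : MvPolynomial (Fin 4) ℂ} (hf : f.IsHomogeneous 6) :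
    ∑ p ∈ Z, c p * eval p.rep f = 0 := by
  have hmon : ∀ m ∈ f.support, ∑ p ∈ Z, c p * ∏ i, p.rep i ^ m i = 0 := by
    intro m hm
    have hdeg : m.sum (fun _ k => k) = 6 := by
      rw [Finsupp.sum_fintype _ _ (by simp), ← Finsupp.degree_eq_sum, Finsupp.degree_eq_weight_one]
      exact hf (mem_support_iff.mp hm)
    have hcoeff := congrArg (coeff m) h
    have hL : ∀ p : PointP3, coeff m (sixthPower p) = m.multinomial * ∏ i, p.rep i ^ m i := by
      intro p
      rw [sixthPower, linearForm]
      simp only [← smul_eq_C_mul]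
      rw [coeff_linearCombination_X_pow_of_fintype, if_pos hdeg, Finsupp.prod_fintype]
      simp
    simp only [coeff_sum, coeff_smul, hL, smul_eq_mul, coeff_zero] at hcoeff
    -- Characteristic zero enters here: multinomial coefficients can be cancelled.
    have hne : (m.multinomial : ℂ) ≠ 0 := Nat.cast_ne_zero.mpr (Nat.multinomial_pos _ _).ne'
    refine (mul_eq_zero.mp ?_).resolve_left hne
    rw [← hcoeff, Finset.mul_sum]
    exact Finset.sum_congr rfl fun p _ => by ring
  simp only [eval_eq', Finset.mul_sum]
  rw [Finset.sum_comm]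
  refine Finset.sum_eq_zero fun m hm => ?_
  rw [← mul_zero (coeff m f), ← hmon m hm, Finset.mul_sum]
  exact Finset.sum_congr rfl fun p _ => by ring

/-- Simultaneous evaluation of polynomials at a family of points. -/
noncomputable def evalHom {κ : Type*} (v : κ → Fin 4 → ℂ) : MvPolynomial (Fin 4) ℂ →ₐ[ℂ] (κ → ℂ) :=
  MvPolynomial.aeval fun i k => v k i

theorem evalHom_apply {κ : Type*} (v : κ → Fin 4 → ℂ) (f : MvPolynomial (Fin 4) ℂ) (k : κ) :
    evalHom v f k = MvPolynomial.eval (v k) f := by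
  have h : (Pi.evalAlgHom ℂ (fun _ => ℂ) k).comp (evalHom v) = MvPolynomial.aeval (v k) := by
    rw [evalHom, MvPolynomial.comp_aeval]
    rfl
  exact congr($h f)

/-- The values of forms of degree `d` at a family of points. -/
noncomputable def formValues {κ : Type*} (v : κ → Fin 4 → ℂ) (d : ℕ) : Submodule ℂ (κ → ℂ) :=
  (MvPolynomial.homogeneousSubmodule (Fin 4) ℂ d).map (evalHom v).toLinearMap

theorem mem_formValues {κ : Type*} {v : κ → Fin 4 → ℂ} {d : ℕ} {g : κ → ℂ} :
    g ∈ formValues v d ↔ ∃ f : MvPolynomial (Fin 4) ℂ, f.IsHomogeneous d ∧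
      ∀ k, MvPolynomial.eval (v k) f = g k := by
  constructor
  · rintro ⟨f, hf, rfl⟩
    exact ⟨f, hf, fun k => (evalHom_apply v f k).symm⟩
  · rintro ⟨f, hf, h⟩
    exact ⟨f, hf, funext fun k => (evalHom_apply v f k).trans (h k)⟩

theorem formValues_one_pow {κ : Type*} (v : κ → Fin 4 → ℂ) (d : ℕ) :
    formValues v 1 ^ d = formValues v d := by
  rw [formValues, ← Submodule.map_pow, MvPolynomial.homogeneousSubmodule_one_pow, formValues]

theorem map_formValues {κ κ' : Type*} (v : κ → Fin 4 → ℂ) (e : κ' → κ) (d : ℕ) :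
    (formValues v d).map (pullbackAlgHom ℂ e).toLinearMap = formValues (v ∘ e) d := by
  ext g
  rw [mem_formValues, Submodule.mem_map]
  constructor
  · rintro ⟨h, hh, rfl⟩
    obtain ⟨f, hf, hfh⟩ := mem_formValues.mp hh
    exact ⟨f, hf, fun k => hfh (e k)⟩
  · rintro ⟨f, hf, hfg⟩
    exact ⟨fun k => MvPolynomial.eval (v k) f, mem_formValues.mpr ⟨f, hf, fun _ => rfl⟩, funext hfg⟩

-- Rescaling a representative by `t ≠ 0` multiplies values in degree `d` by `t ^ d`, so the kernel
-- of evaluation is unchanged.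
open Module in
theorem hilbertFn_eq_finrank_formValues (A : Finset PointP3) (t : PointP3 → ℂ)
    (ht : ∀ p ∈ A, t p ≠ 0) (d : ℕ) :
    hilbertFn (A : Set PointP3) d =
      finrank ℂ (formValues (fun p : A => t p • (p : PointP3).rep) d) := by
  let g := (evalHom fun p : A => t p • (p : PointP3).rep).toLinearMap.comp
    (MvPolynomial.homogeneousSubmodule (Fin 4) ℂ d).subtype
  have hker : Submodule.comap (MvPolynomial.homogeneousSubmodule (Fin 4) ℂ d).subtype
      ((homogeneousIdeal (A : Set PointP3)).restrictScalars ℂ) = LinearMap.ker g := by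
    ext f
    have hf : (f : MvPolynomial (Fin 4) ℂ).IsHomogeneous d := f.2
    rw [Submodule.mem_comap, Submodule.restrictScalars_mem, Submodule.subtype_apply,
      mem_homogeneousIdeal_iff hf, LinearMap.mem_ker, funext_iff, Subtype.forall]
    refine forall₂_congr fun p hp => ?_
    change _ ↔ evalHom _ _ _ = 0
    rw [evalHom_apply, Submodule.subtype_apply, eval_smul_of_isHomogeneous hf, mul_eq_zero,
      or_iff_right (pow_ne_zero _ (ht p hp))]
  have hrange : LinearMap.range g =
      formValues (fun p : A => t p • (p : PointP3).rep) d := by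
    rw [LinearMap.range_comp, Submodule.range_subtype, formValues]
  rw [hilbertFn, hker, g.quotKerEquivRange.finrank_eq, hrange]

/-! ### General position and normalised representatives -/

open Module in
/-- At most twenty points in general position impose independent conditions on cubics. -/
theorem InGeneralPosition.exists_cubic {A : Finset PointP3} (hA : InGeneralPosition A)
    (hcard : A.card ≤ 20) {t : PointP3 → ℂ} (ht : ∀ p ∈ A, t p ≠ 0) {A' : Finset PointP3}
    (hA' : A' ⊆ A) (g : PointP3 → ℂ) :
    ∃ f : MvPolynomial (Fin 4) ℂ, f.IsHomogeneous 3 ∧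
      ∀ p ∈ A', MvPolynomial.eval (t p • p.rep) f = g p := by
  have hle := Finset.card_le_card hA'
  have h3 := hA A' hA' 3
  rw [hilbertFn_eq_finrank_formValues A' t (fun p hp => ht p (hA' hp)),
    show Nat.choose (3 + 3) 3 = 20 from rfl, min_eq_left (by omega)] at h3
  have htop : formValues (fun p : A' => t p • (p : PointP3).rep) 3 = ⊤ := by
    apply Submodule.eq_top_of_finrank_eq
    rw [h3, Module.finrank_fintype_fun_eq_card, Fintype.card_coe]
  have hg : (fun p : A' => g p) ∈ formValues (fun p : A' => t p • (p : PointP3).rep) 3 := by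
    rw [htop]; trivial
  obtain ⟨f, hf, hfg⟩ := mem_formValues.mp hg
  exact ⟨f, hf, fun p hp => hfg ⟨p, hp⟩⟩

open Module in
theorem InGeneralPosition.min_card_le_finrank {A : Finset PointP3} (hA : InGeneralPosition A)
    {t : PointP3 → ℂ} (ht : ∀ p ∈ A, t p ≠ 0) {κ : Type*} [Fintype κ] (e : κ → PointP3)
    (he : Function.Injective e) (heA : ∀ k, e k ∈ A) :
    min (Fintype.card κ) 10 ≤ finrank ℂ (formValues (fun k => t (e k) • (e k).rep) 2) := by
  classical
  have h2 := hA (Finset.univ.image e)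
    (fun p hp => by
      obtain ⟨k, -, rfl⟩ := Finset.mem_image.mp hp
      exact heA k) 2
  rw [hilbertFn_eq_finrank_formValues _ t (fun p hp => by
      obtain ⟨k, -, rfl⟩ := Finset.mem_image.mp hp
      exact ht _ (heA k)), Finset.card_image_of_injective _ he, Finset.card_univ,
    show Nat.choose (2 + 3) 3 = 10 from rfl] at h2
  rw [← h2]
  have hex : ∀ p : ↥(Finset.univ.image e), ∃ k, e k = p := fun p => by
    obtain ⟨k, -, hk⟩ := Finset.mem_image.mp p.2
    exact ⟨k, hk⟩
  choose s hs using hex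
  have hmap := map_formValues (fun k => t (e k) • (e k).rep) s 2
  have hcomp : (fun k => t (e k) • (e k).rep) ∘ s =
      fun p : ↥(Finset.univ.image e) => t p • (p : PointP3).rep := by
    ext1 p
    simp only [Function.comp_apply, hs]
  rw [← hcomp, ← hmap]
  exact Submodule.finrank_map_le _ _

/-- A linear functional that vanishes at none of finitely many points of projective space. -/
theorem exists_dual_rep_ne_zero (Z : Finset PointP3) :
    ∃ φ : Module.Dual ℂ (Fin 4 → ℂ), ∀ p ∈ Z, φ p.rep ≠ 0 := by
  obtain ⟨φ, hφ⟩ := Module.exists_dual_forall_apply_ne_zero (K := ℂ)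
    (fun p : Z => (p : PointP3).rep) fun p => p.1.rep_nonzero
  exact ⟨φ, fun p hp => hφ ⟨p, hp⟩⟩

theorem eval_linearForm_dual (φ : Module.Dual ℂ (Fin 4 → ℂ)) (v : Fin 4 → ℂ) :
    MvPolynomial.eval v (linearForm fun i => φ (Pi.single i 1)) = φ v := by
  rw [eval_linearForm, LinearMap.pi_apply_eq_sum_univ φ v]
  exact Finset.sum_congr rfl fun i _ => by
    rw [smul_eq_mul, mul_comm]
    congr 2
    ext j
    simp [Pi.single_apply, eq_comm]

section Normalized

variable {φ : Module.Dual ℂ (Fin 4 → ℂ)} {Z : Finset PointP3}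

theorem one_mem_formValues (hφ : ∀ p ∈ Z, φ p.rep ≠ 0) :
    1 ∈ formValues (fun p : Z => (φ (p : PointP3).rep)⁻¹ • (p : PointP3).rep) 1 := by
  refine mem_formValues.mpr ⟨_, isHomogeneous_linearForm fun i => φ (Pi.single i 1), fun p => ?_⟩
  rw [eval_linearForm_dual, map_smul, smul_eq_mul, inv_mul_cancel₀ (hφ p p.2), Pi.one_apply]

theorem exists_formValues_ne (hφ : ∀ p ∈ Z, φ p.rep ≠ 0) (p q : Z) (hpq : p ≠ q) :
    ∃ f ∈ formValues (fun p : Z => (φ (p : PointP3).rep)⁻¹ • (p : PointP3).rep) 1, f p ≠ f q := by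
  by_contra! h
  apply hpq
  have hv : (φ (p : PointP3).rep)⁻¹ • (p : PointP3).rep =
      (φ (q : PointP3).rep)⁻¹ • (q : PointP3).rep := by
    ext i
    have := h _ (mem_formValues.mpr
      ⟨MvPolynomial.X i, MvPolynomial.isHomogeneous_X _ i, fun _ => rfl⟩)
    simpa using this
  apply Subtype.ext
  rw [← Projectivization.mk_rep p.1, ← Projectivization.mk_rep q.1,
    Projectivization.mk_eq_mk_iff']
  refine ⟨φ (p : PointP3).rep * (φ (q : PointP3).rep)⁻¹, ?_⟩
  rw [mul_smul, ← hv, smul_inv_smul₀ (hφ p p.2)]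

/-- The factor `φ ^ 6` in the coefficients compensates the scaling of sextic values by `φ⁻¹ ^ 6`. -/
theorem isRelation_formValues (hφ : ∀ p ∈ Z, φ p.rep ≠ 0) {c : PointP3 → ℂ}
    (h : ∑ p ∈ Z, c p • sixthPower p = 0) :
    IsRelation (formValues (fun p : Z => (φ (p : PointP3).rep)⁻¹ • (p : PointP3).rep) 1 ^ 6)
      (fun p : Z => c p * φ (p : PointP3).rep ^ 6) := by
  rw [formValues_one_pow]
  intro g hg
  obtain ⟨f, hf, hfg⟩ := mem_formValues.mp hg
  rw [← sum_mul_eval_eq_zero Z c h hf, ← Finset.sum_coe_sort Z]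
  refine Finset.sum_congr rfl fun p _ => ?_
  rw [← hfg, eval_smul_of_isHomogeneous hf, mul_assoc, ← mul_assoc (_ ^ 6), ← mul_pow,
    mul_inv_cancel₀ (hφ p p.2), one_pow, one_mul]

theorem interpolates_formValues {A : Finset PointP3} (hA : InGeneralPosition A)
    (hcard : A.card ≤ 20) (hφA : ∀ p ∈ A, φ p.rep ≠ 0) {S : Finset Z}
    (hS : ∀ p ∈ S, (p : PointP3) ∈ A) :
    Interpolates (formValues (fun p : Z => (φ (p : PointP3).rep)⁻¹ • (p : PointP3).rep) 1 ^ 3)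
      S := by
  classical
  rw [formValues_one_pow]
  intro g
  obtain ⟨f, hf, hfg⟩ := hA.exists_cubic hcard (t := fun p => (φ p.rep)⁻¹)
    (fun p hp => inv_ne_zero (hφA p hp)) (A' := S.map (Function.Embedding.subtype _)) (by
      intro p hp
      obtain ⟨q, hq, rfl⟩ := Finset.mem_map.mp hp
      exact hS q hq) (fun p => if hp : p ∈ Z then g ⟨p, hp⟩ else 0)
  refine ⟨_, mem_formValues.mpr ⟨f, hf, fun _ => rfl⟩, fun p hp => ?_⟩
  rw [hfg p (Finset.mem_map_of_mem _ hp), dif_pos p.2]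

end Normalized

/-! ### Comparison of the two decompositions -/

theorem mainTheorem5 (F : MvPolynomial (Fin 4) ℂ) (A B : Finset PointP3)
    (hr : A.card ≤ 20)
    (hA : IsNonredundantDecomposition F A)
    (hGP : InGeneralPosition A)
    (hB : IsDecomposition F B) :
    A.card ≤ B.card ∧
      (B.card ≤ A.card →
        (A.card = 15 → B ≠ A → Disjoint A B) ∧
        ∀ d : ℕ, d ≤ 3 → ∀ f : MvPolynomial (Fin 4) ℂ, f.IsHomogeneous d →
          (f ∈ homogeneousIdeal (A : Set PointP3) ↔
            f ∈ homogeneousIdeal ((A : Set PointP3) ∪ (B : Set PointP3)))) := by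
  classical
  obtain ⟨-, a, ha, hFa⟩ := hA
  obtain ⟨b, hFb⟩ := hB
  obtain ⟨φ, hφ⟩ := exists_dual_rep_ne_zero (A ∪ B)
  have hφA : ∀ p ∈ A, φ p.rep ≠ 0 := fun p hp => hφ p (Finset.mem_union_left _ hp)
  set c : PointP3 → ℂ := fun p => (if p ∈ A then a p else 0) - (if p ∈ B then b p else 0) with hc
  -- Common points with equal coefficients drop out, so the relation has full support on `Z`.
  set Z : Finset PointP3 := (A ∪ B).filter fun p => c p ≠ 0 with hZ
  have hφZ : ∀ p ∈ Z, φ p.rep ≠ 0 := fun p hp => hφ p (Finset.filter_subset _ _ hp)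
  have hcZ : ∑ p ∈ Z, c p • sixthPower p = 0 := by
    have hsum : ∑ p ∈ A ∪ B, c p • sixthPower p = 0 := by
      simp only [hc, sub_smul, Finset.sum_sub_distrib, ite_smul, zero_smul]
      rw [← Finset.sum_filter, ← Finset.sum_filter, Finset.filter_mem_eq_inter,
        Finset.filter_mem_eq_inter, Finset.union_inter_cancel_left,
        Finset.union_inter_cancel_right, ← hFa, ← hFb, sub_self]
    rw [← hsum]
    refine Finset.sum_subset (Finset.filter_subset _ _) fun p hp hpZ => ?_
    have : c p = 0 := by
      by_contra h0
      exact hpZ (Finset.mem_filter.mpr ⟨hp, h0⟩)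
    rw [this, zero_smul]
  have hAB : A \ B ⊆ Z ∩ A := by
    intro p hp
    obtain ⟨hpA, hpB⟩ := Finset.mem_sdiff.mp hp
    refine Finset.mem_inter.mpr ⟨Finset.mem_filter.mpr ⟨Finset.mem_union_left _ hpA, ?_⟩, hpA⟩
    simpa [hc, hpA, hpB] using ha p hpA
  have hZA : Z \ A ⊆ B \ A := by
    intro p hp
    obtain ⟨hpZ, hpA⟩ := Finset.mem_sdiff.mp hp
    exact Finset.mem_sdiff.mpr
      ⟨(Finset.mem_union.mp (Finset.filter_subset _ _ hpZ)).resolve_left hpA, hpA⟩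
  set S : Finset Z := Finset.univ.filter fun p => (p : PointP3) ∈ A with hS
  have hScard : S.card = (Z ∩ A).card := by
    rw [← Finset.card_map (Function.Embedding.subtype _)]
    congr 1
    ext p
    simp [hS, and_comm]
  have hrel := isRelation_formValues hφZ hcZ
  have hne : ∀ p : Z, c p * φ (p : PointP3).rep ^ 6 ≠ 0 := fun p =>
    mul_ne_zero (Finset.mem_filter.mp p.2).2 (pow_ne_zero _ (hφZ p p.2))
  have hSA : ∀ p ∈ S, (p : PointP3) ∈ A := fun p hp => (Finset.mem_filter.mp hp).2
  have hint := interpolates_formValues hGP hr hφA hSA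
  have h2S := IsRelation.two_mul_card_le (d := 3) hrel hne hint
  rw [Fintype.card_coe] at h2S
  have e1 := Finset.card_le_card hAB
  have e2 := Finset.card_le_card hZA
  have e3 := Finset.card_inter_add_card_sdiff Z A
  have e4 := Finset.card_inter_add_card_sdiff A B
  have e5 := Finset.card_inter_add_card_sdiff B A
  rw [Finset.inter_comm B A] at e5
  refine ⟨by omega, fun hBA => ⟨fun h15 hne' => ?_, fun d hd f hf => ?_⟩⟩
  · by_contra hdis
    have hpos : 0 < (A ∩ B).card :=
      Finset.card_pos.mpr (Finset.nonempty_iff_ne_empty.mpr fun h =>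
        hdis (Finset.disjoint_iff_inter_eq_empty.mpr h))
    have hpos' : 0 < (A \ B).card := by
      rw [Finset.card_pos, Finset.sdiff_nonempty]
      exact fun hsub => hne' (Finset.eq_of_subset_of_card_le hsub hBA).symm
    -- A common point gives `|S| ≤ |B \ A| ≤ 14`, and the equalities give `|Z| = 2|S|`.
    refine false_of_isRelation_pow_six (one_mem_formValues hφZ) (exists_formValues_ne hφZ) hrel hne
      hint (by rw [Fintype.card_coe]; omega) (by omega) (by omega) fun T hT => ?_
    rw [formValues_one_pow, map_formValues]
    have := hGP.min_card_le_finrank (t := fun p => (φ p.rep)⁻¹)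
      (fun p hp => inv_ne_zero (hφA p hp)) (fun p : T => ((p : Z) : PointP3))
      (Subtype.val_injective.comp Subtype.val_injective) fun p => hSA _ (hT p.2)
    rwa [Fintype.card_coe] at this
  · rw [mem_homogeneousIdeal_iff hf, mem_homogeneousIdeal_iff hf]
    refine ⟨fun h p hp => ?_, fun h p hp => h p (Or.inl hp)⟩
    by_cases hpA : p ∈ A
    · exact h p hpA
    have hpZ : p ∈ Z := by
      have hpBA : p ∈ B \ A := Finset.mem_sdiff.mpr ⟨hp.resolve_left hpA, hpA⟩
      rw [← Finset.eq_of_subset_of_card_le hZA (by omega)] at hpBA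
      exact (Finset.mem_sdiff.mp hpBA).1
    have hrank := IsRelation.finrank_eq (d := 3) hrel hne hint (by rw [Fintype.card_coe]; omega)
    -- Multiplying by a power of the linear form of `φ`, nonzero on `Z`, raises `f` to degree 3
    -- without changing its zeros on `Z`.
    have hhom : (f * linearForm (fun i => φ (Pi.single i 1)) ^ (3 - d)).IsHomogeneous 3 := by
      have := hf.mul ((isHomogeneous_linearForm fun i => φ (Pi.single i 1)).pow (3 - d))
      rwa [one_mul, Nat.add_sub_cancel' hd] at this
    have hzero := hint.card_le_finrank.2 hrank.le _
      (by rw [formValues_one_pow]; exact mem_formValues.mpr ⟨_, hhom, fun _ => rfl⟩)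
      (fun q hq => by
        rw [eval_smul_of_isHomogeneous hhom, map_mul, h q (hSA q hq), zero_mul, mul_zero])
    have hp0 := congrFun hzero ⟨p, hpZ⟩
    rw [Pi.zero_apply, eval_smul_of_isHomogeneous hhom, map_mul, map_pow, eval_linearForm_dual]
      at hp0
    have hφp := hφZ p hpZ
    exact (mul_eq_zero.mp ((mul_eq_zero.mp hp0).resolve_left
      (pow_ne_zero _ (inv_ne_zero hφp)))).resolve_right (pow_ne_zero _ hφp)
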